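/- Let $(\Omega,\mathcal F,\mathbb P)$ be an atomless probability space. For an essentially bounded random variable $X$ let $Q_X:[0,1]\to\mathbb R$ be its quantile function, $Q_X(p)=\inf\{x\in\mathbb R:\mathbb P(X\le x)\ge p\}$ for $p\in(0,1]$ and $Q_X(0)=\inf\{x\in\mathbb R:\mathbb P(X\le x)>0\}$. Call a random vector $(Y_1,\dots,Y_n)$ \emph{comonotonic} if there are a random variable $W$ and nondecreasing functions $f_1,\dots,f_n:\mathbb R\to\mathbb R$ with $(Y_1,\dots,Y_n)=(f_1(W),\dots,f_n(W))$ almost surely. Let $g:[0,1]\to\mathbb R$ be a left-continuous risk spectrum, that is, a nonnegative nondecreasing function which is left-continuous on $(0,1]$, right-continuous at $0$, and satisfies $\int_0^1 g(t)\,dt=1$. Let $\rho_g(X)=\int_0^1 g(t)Q_X(t)\,dt$ be the corresponding spectral risk measure on $L^\infty(\Omega,\mathcal F,\mathbb P)$. Then for every random vector $\mathbf X=(X_1,\dots,X_d)$ with essentially bounded components, $\rho_g$ is additive on $\mathbf X$, i.e. $$\rho_g(X_1+\dots+X_d)=\rho_g(X_1)+\dots+\rho_g(X_d),$$ if and only if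 $\mathbf X$ is $g$-comonotonic, i.e. there is a random variable $Z$ on $\Omega$ with $Q_Z=g$ on $[0,1]$ such that $(X_i,Z)$ is comonotonic for every $i=1,\dots,d$. -/

import Mathlib

open MeasureTheory Set
open scoped ENNReal

namespace SpectralRisk

/-- A measure is atomless (non-atomic): every measurable set of positive measure has a measurable
subset of positive and strictly smaller measure. (Mathlib's classes about null singletons
only say this for sufficiently regular measurable spaces.) -/
def IsAtomless {Ω : Type*} [MeasurableSpace Ω] (P : Measure Ω) : Prop :=
  ∀ A : Set Ω, MeasurableSet A → 0 < P A →
    ∃ B : Set Ω, MeasurableSet B ∧ B ⊆ A ∧ 0 < P B ∧ P B < P A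

/-- The left quantile function `Q⁻_X(p) = inf {x : P(X ≤ x) ≥ p}`. -/
noncomputable def leftQuantile {Ω : Type*} [MeasurableSpace Ω] (P : Measure Ω) (X : Ω → ℝ)
    (p : ℝ) : ℝ :=
  sInf {x : ℝ | p ≤ P.real {ω | X ω ≤ x}}

/-- The right quantile function `Q⁺_X(p) = inf {x : P(X ≤ x) > p}`. -/
noncomputable def rightQuantile {Ω : Type*} [MeasurableSpace Ω] (P : Measure Ω) (X : Ω → ℝ)
    (p : ℝ) : ℝ :=
  sInf {x : ℝ | p < P.real {ω | X ω ≤ x}}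

/-- The quantile function `Q_X` on `[0,1]`: it is `Q⁻_X` on `(0,1]` and `Q⁺_X` at `0`
(values outside `[0,1]` are never used). -/
noncomputable def quantile {Ω : Type*} [MeasurableSpace Ω] (P : Measure Ω) (X : Ω → ℝ)
    (p : ℝ) : ℝ :=
  if p = 0 then rightQuantile P X 0 else leftQuantile P X p

/-- `g : [0,1] → ℝ` (only the values on `[0,1]` matter) is a left-continuous risk spectrum:
nonnegative, nondecreasing, left-continuous on `(0,1]`, right-continuous at `0`, of integral `1`. -/
structure IsRiskSpectrum (g : ℝ → ℝ) : Prop where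
  nonneg : ∀ t ∈ Icc (0 : ℝ) 1, 0 ≤ g t
  mono : MonotoneOn g (Icc 0 1)
  leftCont : ∀ t ∈ Ioc (0 : ℝ) 1, ContinuousWithinAt g (Iio t) t
  rightCont_zero : ContinuousWithinAt g (Ioi 0) 0
  integral_eq_one : ∫ t in (0 : ℝ)..1, g t = 1

/-- The spectral risk measure `ρ_g(X) = ∫₀¹ g(t) Q_X(t) dt`. -/
noncomputable def spectralRisk {Ω : Type*} [MeasurableSpace Ω] (P : Measure Ω) (g : ℝ → ℝ)
    (X : Ω → ℝ) : ℝ :=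
  ∫ t in (0 : ℝ)..1, g t * quantile P X t

/-- A random vector is comonotonic if its components are almost surely nondecreasing functions of
one common random variable. -/
def Comonotonic {Ω : Type*} [MeasurableSpace Ω] (P : Measure Ω) {d : ℕ}
    (X : Fin d → Ω → ℝ) : Prop :=
  ∃ (W : Ω → ℝ) (f : Fin d → ℝ → ℝ), Measurable W ∧ (∀ i, Monotone (f i)) ∧
    ∀ᵐ ω ∂P, ∀ i, X i ω = f i (W ω)

/-- A random vector `X` is `g`-comonotonic if some random variable `Z` with quantile function `g`
is comonotonic with each component of `X`. -/
def GComonotonic {Ω : Type*} [MeasurableSpace Ω] (P : Measure Ω) (g : ℝ → ℝ) {d : ℕ}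
    (X : Fin d → Ω → ℝ) : Prop :=
  ∃ Z : Ω → ℝ, Measurable Z ∧ (∀ p ∈ Icc (0 : ℝ) 1, quantile P Z p = g p) ∧
    ∀ i, Comonotonic P ![X i, Z]

/-- The functional `ρ` is additive on the random vector `X`. -/
def AdditiveOn {Ω : Type*} (ρ : (Ω → ℝ) → ℝ) {d : ℕ} (X : Fin d → Ω → ℝ) : Prop :=
  ρ (fun ω => ∑ i, X i ω) = ∑ i, ρ (X i)

end SpectralRisk

/-!
The spectral risk measure is the maximal correlation functional
`ρ_g(X) = max {E[XZ] : Q_Z = g}`, and for a given `Z` with `Q_Z = g` the maximum is attained exactly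
when `X` and `Z` are comonotone (`integral_mul_le_spectralRisk`). Both halves of the theorem follow
from this and from the linearity of `X ↦ E[XZ]`.

* If one `Z` is comonotone with every `X i`, it is comonotone with the sum `S`, so
  `ρ_g(S) = E[SZ] = ∑ E[X i Z] = ∑ ρ_g(X i)`.
* Conversely, pick `Z` with `Q_Z = g` comonotone with `S`. Then additivity gives
  `∑ E[X i Z] = E[SZ] = ρ_g(S) = ∑ ρ_g(X i)`, where every summand on the left is at most the
  corresponding one on the right. Hence all of them agree, and `Z` is comonotone with every `X i`.

The characterisation of the maximum is the Hardy-Littlewood inequality with its equality case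
(`integral_mul_le_of_identDistrib_of_monovaryOn`): up to shifts, `E[XZ]` is the integral of
`P(X > x, Z > z)` over all levels `(x, z)`, and this joint survival function is bounded by
`min (P(X > x)) (P(Z > z))`, with equality at almost all levels exactly for comonotone pairs. It is
applied to compare `(X, Z)` on `Ω` with the comonotone pair `(Q_X, Q_Z)` on `(0, 1)`.

Atomlessness enters through the existence of `Z`
(`IsAtomless.exists_quantile_eq_and_monovaryOn`): the values of `S` are refined to a random variable
`T` without atoms, whose distribution function turns it into a uniform `U`, and `Z = g(U)`.

Comonotonicity of a pair is used in the pointwise form `MonovaryOn X Z A` for a set `A` of full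
measure; `comonotonic_pair_iff` relates it to the representation by monotone functions.
-/

namespace SpectralRisk

open ProbabilityTheory Filter Topology

/-! ### The rearrangement inequality and its equality case -/

section Rearrangement

variable {α β : Type*} [MeasurableSpace α] [MeasurableSpace β] {μ : Measure α} {ν : Measure β}

lemma measurable_measure_lt_and_lt [SFinite μ] {f h : α → ℝ} (hf : AEMeasurable f μ)
    (hh : AEMeasurable h μ) : Measurable fun p : ℝ × ℝ => μ {ω | p.1 < f ω ∧ p.2 < h ω} := by
  have key : (fun p : ℝ × ℝ => μ {ω | p.1 < f ω ∧ p.2 < h ω}) =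
      fun p : ℝ × ℝ => μ {ω | p.1 < hf.mk f ω ∧ p.2 < hh.mk h ω} := by
    funext p
    refine measure_congr ?_
    filter_upwards [hf.ae_eq_mk, hh.ae_eq_mk] with ω h1 h2
    change (p.1 < f ω ∧ p.2 < h ω) = (p.1 < hf.mk f ω ∧ p.2 < hh.mk h ω)
    rw [h1, h2]
  rw [key]
  have hm1 := hf.measurable_mk
  have hm2 := hh.measurable_mk
  have hs : MeasurableSet {q : (ℝ × ℝ) × α | q.1.1 < hf.mk f q.2 ∧ q.1.2 < hh.mk h q.2} := by
    simp only [ofPred_and]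
    exact (measurableSet_lt (by fun_prop) (by fun_prop)).inter
      (measurableSet_lt (by fun_prop) (by fun_prop))
  exact measurable_measure_prodMk_left hs

/-- The layer cake formula for the expectation of a product, in terms of the joint survival
function. -/
lemma lintegral_ofReal_sub_mul_ofReal_sub [SFinite μ] {f h : α → ℝ} (hf : AEMeasurable f μ)
    (hh : AEMeasurable h μ) (a b : ℝ) :
    ∫⁻ ω, ENNReal.ofReal (f ω - a) * ENNReal.ofReal (h ω - b) ∂μ =
      ∫⁻ p in Ioi a ×ˢ Ioi b, μ {ω | p.1 < f ω ∧ p.2 < h ω} := by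
  wlog hm : Measurable f ∧ Measurable h generalizing f h
  · have := this hf.measurable_mk.aemeasurable hh.measurable_mk.aemeasurable
      ⟨hf.measurable_mk, hh.measurable_mk⟩
    have e1 : ∫⁻ ω, ENNReal.ofReal (f ω - a) * ENNReal.ofReal (h ω - b) ∂μ =
        ∫⁻ ω, ENNReal.ofReal (hf.mk f ω - a) * ENNReal.ofReal (hh.mk h ω - b) ∂μ := by
      refine lintegral_congr_ae ?_
      filter_upwards [hf.ae_eq_mk, hh.ae_eq_mk] with ω h1 h2
      rw [h1, h2]
    rw [e1, this]
    refine lintegral_congr fun p => measure_congr ?_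
    filter_upwards [hf.ae_eq_mk, hh.ae_eq_mk] with ω h1 h2
    change (p.1 < hf.mk f ω ∧ p.2 < hh.mk h ω) = (p.1 < f ω ∧ p.2 < h ω)
    rw [h1, h2]
  obtain ⟨hfm, hhm⟩ := hm
  set Q : Measure (ℝ × ℝ) := volume.restrict (Ioi a ×ˢ Ioi b) with hQ
  have hs : MeasurableSet {q : (ℝ × ℝ) × α | q.1.1 < f q.2 ∧ q.1.2 < h q.2} := by
    simp only [ofPred_and]
    exact (measurableSet_lt (by fun_prop) (by fun_prop)).inter
      (measurableSet_lt (by fun_prop) (by fun_prop))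
  have h1 := Measure.prod_apply (μ := Q) (ν := μ) hs
  have h2 := Measure.prod_apply_symm (μ := Q) (ν := μ) hs
  change _ = ∫⁻ p, μ {ω | p.1 < f ω ∧ p.2 < h ω} ∂Q
  rw [show (∫⁻ p, μ {ω | p.1 < f ω ∧ p.2 < h ω} ∂Q) = _ from h1.symm, h2]
  refine lintegral_congr fun ω => ?_
  have hset : ((fun x => (x, ω)) ⁻¹' {q : (ℝ × ℝ) × α | q.1.1 < f q.2 ∧ q.1.2 < h q.2})
      = Iio (f ω) ×ˢ Iio (h ω) := by
    ext p; simp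
  rw [hset, hQ, Measure.restrict_apply (measurableSet_Iio.prod measurableSet_Iio), prod_inter_prod,
    Measure.volume_eq_prod, Measure.prod_prod, inter_comm, Ioi_inter_Iio, inter_comm,
    Ioi_inter_Iio, Real.volume_Ioo, Real.volume_Ioo]

/-- For a comonotone pair the survival events are nested up to null sets, so the joint survival
function is the minimum of the marginal ones. -/
lemma measure_lt_and_lt_of_monovaryOn {f h : α → ℝ} {A : Set α} (hA : A ∈ ae μ)
    (hfh : MonovaryOn f h A) (x z : ℝ) :
    μ {ω | x < f ω ∧ z < h ω} = min (μ {ω | x < f ω}) (μ {ω | z < h ω}) := by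
  refine le_antisymm (le_min (measure_mono fun ω hω => hω.1) (measure_mono fun ω hω => hω.2)) ?_
  by_cases hc : ∃ ω ∈ A, x < f ω ∧ h ω ≤ z
  · obtain ⟨ω, hωA, hx, hz⟩ := hc
    refine (min_le_right _ _).trans (measure_mono_ae ?_)
    filter_upwards [hA] with ω' hω' hzω'
    exact ⟨hx.trans_le (hfh hωA hω' (hz.trans_lt hzω')), hzω'⟩
  · push Not at hc
    refine (min_le_left _ _).trans (measure_mono_ae ?_)
    filter_upwards [hA] with ω' hω' hxω'
    exact ⟨hxω', hc ω' hω' hxω'⟩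

/-- If the survival events of `f` and `h` are nested for almost every pair of levels, then the pair
is comonotone off a null set: it suffices to look at a countable dense set of levels. -/
lemma exists_monovaryOn_of_ae_measure_lt_and_lt_eq_min [IsFiniteMeasure μ] {f h : α → ℝ}
    (hf : AEMeasurable f μ) (hh : AEMeasurable h μ) {a b : ℝ}
    (hfa : ∀ᵐ ω ∂μ, a ≤ f ω) (hhb : ∀ᵐ ω ∂μ, b ≤ h ω)
    (hmin : ∀ᵐ p : ℝ × ℝ ∂(volume.restrict (Ioi a ×ˢ Ioi b)),
      μ {ω | p.1 < f ω ∧ p.2 < h ω} = min (μ {ω | p.1 < f ω}) (μ {ω | p.2 < h ω})) :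
    ∃ A ∈ ae μ, MonovaryOn f h A := by
  rw [ae_restrict_iff' (measurableSet_Ioi.prod measurableSet_Ioi)] at hmin
  have hdense := Measure.dense_of_ae hmin
  obtain ⟨D, hDs, hDc, hDd⟩ := hdense.exists_countable_dense_subset
  let L : ℝ × ℝ → Prop := fun p => ∀ᵐ ω ∂μ, p.1 < f ω → p.2 < h ω
  let R : ℝ × ℝ → Prop := fun p => ∀ᵐ ω ∂μ, p.2 < h ω → p.1 < f ω
  have hLR : ∀ p ∈ D, p ∈ Ioi a ×ˢ Ioi b → L p ∨ R p := by
    intro p hp hpq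
    have hp' := hDs hp hpq
    have hsub1 : {ω | p.1 < f ω ∧ p.2 < h ω} ⊆ {ω | p.1 < f ω} := fun ω hω => hω.1
    have hsub2 : {ω | p.1 < f ω ∧ p.2 < h ω} ⊆ {ω | p.2 < h ω} := fun ω hω => hω.2
    have hm1 : NullMeasurableSet {ω | p.1 < f ω} μ := nullMeasurableSet_lt aemeasurable_const hf
    have hm2 : NullMeasurableSet {ω | p.2 < h ω} μ := nullMeasurableSet_lt aemeasurable_const hh
    have hm : NullMeasurableSet {ω | p.1 < f ω ∧ p.2 < h ω} μ := hm1.inter hm2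
    rcases le_total (μ {ω | p.1 < f ω}) (μ {ω | p.2 < h ω}) with hle | hle
    · left
      rw [min_eq_left hle] at hp'
      have := ae_eq_of_subset_of_measure_ge hsub1 hp'.ge hm (measure_ne_top _ _)
      filter_upwards [this.mem_iff] with ω hω hx
      exact (hω.2 hx).2
    · right
      rw [min_eq_right hle] at hp'
      have := ae_eq_of_subset_of_measure_ge hsub2 hp'.ge hm (measure_ne_top _ _)
      filter_upwards [this.mem_iff] with ω hω hx
      exact (hω.2 hx).1
  have hall : ∀ᵐ ω ∂μ, ∀ p ∈ D,
      (L p → p.1 < f ω → p.2 < h ω) ∧ (R p → p.2 < h ω → p.1 < f ω) := by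
    rw [ae_ball_iff hDc]
    intro p _
    refine Filter.Eventually.and ?_ ?_
    · by_cases hp : L p
      · filter_upwards [hp] with ω hω _ using hω
      · exact Filter.Eventually.of_forall fun ω hp' => absurd hp' hp
    · by_cases hp : R p
      · filter_upwards [hp] with ω hω _ using hω
      · exact Filter.Eventually.of_forall fun ω hp' => absurd hp' hp
  refine ⟨_, hall.and (hfa.and hhb), ?_⟩
  rintro ω ⟨hω, hωa, hωb⟩ ω' ⟨hω', hωa', hωb'⟩ hlt
  by_contra! hlt'
  -- a good level strictly between the two values separates `ω` from `ω'` in both coordinates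
  obtain ⟨p, hpo, hpD⟩ := hDd.inter_open_nonempty (Ioo (f ω') (f ω) ×ˢ Ioo (h ω) (h ω'))
    (isOpen_Ioo.prod isOpen_Ioo) ((nonempty_Ioo.2 hlt').prod (nonempty_Ioo.2 hlt))
  obtain ⟨⟨h1, h2⟩, h3, h4⟩ := hpo
  rcases hLR p hpD ⟨hωa'.trans_lt h1, hωb.trans_lt h3⟩ with hL | hR
  · exact absurd ((hω p hpD).1 hL h2) h3.not_gt
  · exact absurd ((hω' p hpD).2 hR h4) h1.not_gt

lemma exists_ae_abs_le {f : α → ℝ} (hf : MemLp f ∞ μ) : ∃ M : ℝ, ∀ᵐ ω ∂μ, |f ω| ≤ M := by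
  have hlt : eLpNormEssSup f μ < ∞ := by simpa [eLpNorm_exponent_top] using hf.2
  refine ⟨(eLpNormEssSup f μ).toReal, ?_⟩
  filter_upwards [ae_le_eLpNormEssSup (f := f) (μ := μ)] with ω hω
  rw [← Real.norm_eq_abs, ← toReal_enorm]
  exact ENNReal.toReal_mono hlt.ne hω

lemma integral_mul_eq_integral_sub_mul_sub [IsProbabilityMeasure μ] {u v : α → ℝ}
    (hu : MemLp u ∞ μ) (hv : MemLp v ∞ μ) (a b : ℝ) :
    ∫ ω, u ω * v ω ∂μ =
      ∫ ω, (u ω - a) * (v ω - b) ∂μ + b * ∫ ω, u ω ∂μ + a * ∫ ω, v ω ∂μ - a * b := by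
  have i1 : Integrable (fun ω => u ω * v ω) μ := MemLp.integrable le_top (hv.mul hu)
  have i2 := hu.integrable (q := ∞) le_top
  have i3 := hv.integrable (q := ∞) le_top
  have : ∫ ω, (u ω - a) * (v ω - b) ∂μ =
      ∫ ω, (u ω * v ω - b * u ω - a * v ω + a * b) ∂μ := by
    congr 1; ext ω; ring
  rw [this, integral_add, integral_sub, integral_sub, integral_const_mul, integral_const_mul,
    integral_const]
  · simp only [probReal_univ, one_smul]; ring
  all_goals fun_prop

lemma ofReal_integral_sub_mul_sub [IsProbabilityMeasure μ] {f h : α → ℝ}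
    (hf : MemLp f ∞ μ) (hh : MemLp h ∞ μ) {a b : ℝ}
    (hfa : ∀ᵐ ω ∂μ, a ≤ f ω) (hhb : ∀ᵐ ω ∂μ, b ≤ h ω) :
    ENNReal.ofReal (∫ ω, (f ω - a) * (h ω - b) ∂μ) =
      ∫⁻ p in Ioi a ×ˢ Ioi b, μ {ω | p.1 < f ω ∧ p.2 < h ω} := by
  have hint : Integrable (fun ω => (f ω - a) * (h ω - b)) μ :=
    MemLp.integrable le_top ((hh.sub (memLp_const b)).mul (hf.sub (memLp_const a)))
  rw [ofReal_integral_eq_lintegral_ofReal hint, ← lintegral_ofReal_sub_mul_ofReal_sub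
    hf.1.aemeasurable hh.1.aemeasurable]
  · refine lintegral_congr_ae ?_
    filter_upwards [hfa] with ω h1
    exact ENNReal.ofReal_mul (sub_nonneg.2 h1)
  · filter_upwards [hfa, hhb] with ω h1 h2
    exact mul_nonneg (sub_nonneg.2 h1) (sub_nonneg.2 h2)

/-- The Hardy-Littlewood rearrangement inequality for bounded functions, with its equality case:
among all couplings of two given laws, exactly the comonotone ones maximise the expectation of the
product. -/
theorem integral_mul_le_of_identDistrib_of_monovaryOn [IsProbabilityMeasure μ]
    [IsProbabilityMeasure ν]
    {f h : α → ℝ} {f' h' : β → ℝ} (hff : IdentDistrib f f' μ ν) (hhh : IdentDistrib h h' μ ν)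
    (hf : MemLp f ∞ μ) (hh : MemLp h ∞ μ) {B : Set β} (hB : B ∈ ae ν) (hmono : MonovaryOn f' h' B) :
    ∫ ω, f ω * h ω ∂μ ≤ ∫ t, f' t * h' t ∂ν ∧
      (∫ ω, f ω * h ω ∂μ = ∫ t, f' t * h' t ∂ν ↔ ∃ A ∈ ae μ, MonovaryOn f h A) := by
  obtain ⟨M, hM⟩ := exists_ae_abs_le hf
  obtain ⟨N, hN⟩ := exists_ae_abs_le hh
  obtain ⟨a, hfa⟩ : ∃ a, ∀ᵐ ω ∂μ, a ≤ f ω := ⟨-M, hM.mono fun ω hω => neg_le_of_abs_le hω⟩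
  obtain ⟨b, hhb⟩ : ∃ b, ∀ᵐ ω ∂μ, b ≤ h ω := ⟨-N, hN.mono fun ω hω => neg_le_of_abs_le hω⟩
  have hfa' : ∀ᵐ t ∂ν, a ≤ f' t := hff.ae_mem_snd measurableSet_Ici hfa
  have hhb' : ∀ᵐ t ∂ν, b ≤ h' t := hhh.ae_mem_snd measurableSet_Ici hhb
  have hf' : MemLp f' ∞ ν := hff.memLp_snd hf
  have hh' : MemLp h' ∞ ν := hhh.memLp_snd hh
  have hmf : ∀ x, μ {ω | x < f ω} = ν {t | x < f' t} := fun x =>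
    hff.measure_mem_eq measurableSet_Ioi
  have hmh : ∀ z, μ {ω | z < h ω} = ν {t | z < h' t} := fun z =>
    hhh.measure_mem_eq measurableSet_Ioi
  have hν : ∀ p : ℝ × ℝ, ν {t | p.1 < f' t ∧ p.2 < h' t} =
      min (μ {ω | p.1 < f ω}) (μ {ω | p.2 < h ω}) := fun p => by
    rw [measure_lt_and_lt_of_monovaryOn hB hmono, hmf, hmh]
  have hle : ∀ p : ℝ × ℝ, μ {ω | p.1 < f ω ∧ p.2 < h ω} ≤ ν {t | p.1 < f' t ∧ p.2 < h' t} :=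
    fun p => by
      rw [hν]
      exact le_min (measure_mono fun ω hω => hω.1) (measure_mono fun ω hω => hω.2)
  have e := ofReal_integral_sub_mul_sub hf hh hfa hhb
  have e' := ofReal_integral_sub_mul_sub hf' hh' hfa' hhb'
  have hnn : 0 ≤ ∫ t, (f' t - a) * (h' t - b) ∂ν := by
    refine integral_nonneg_of_ae ?_
    filter_upwards [hfa', hhb'] with t h1 h2
    exact mul_nonneg (sub_nonneg.2 h1) (sub_nonneg.2 h2)
  have hle' : ∫ ω, (f ω - a) * (h ω - b) ∂μ ≤ ∫ t, (f' t - a) * (h' t - b) ∂ν := by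
    rw [← ENNReal.ofReal_le_ofReal_iff hnn, e, e']
    exact lintegral_mono hle
  rw [integral_mul_eq_integral_sub_mul_sub hf hh a b,
    integral_mul_eq_integral_sub_mul_sub hf' hh' a b, hff.integral_eq, hhh.integral_eq]
  refine ⟨by linarith, fun heq => ?_, ?_⟩
  · have heq' : ∫ ω, (f ω - a) * (h ω - b) ∂μ = ∫ t, (f' t - a) * (h' t - b) ∂ν := by linarith
    refine exists_monovaryOn_of_ae_measure_lt_and_lt_eq_min hf.1.aemeasurable hh.1.aemeasurable
      hfa hhb ?_
    rw [heq', e'] at e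
    have := ae_eq_of_ae_le_of_lintegral_le (Filter.Eventually.of_forall hle)
      (by rw [← e]; rw [← e']; exact ENNReal.ofReal_ne_top)
      (measurable_measure_lt_and_lt hf'.1.aemeasurable hh'.1.aemeasurable).aemeasurable e.le
    filter_upwards [this] with p hp
    rw [hp, hν]
  · rintro ⟨A, hA, hmonoA⟩
    have : ∫ ω, (f ω - a) * (h ω - b) ∂μ = ∫ t, (f' t - a) * (h' t - b) ∂ν := by
      refine le_antisymm hle' ?_
      have hnn' : 0 ≤ ∫ ω, (f ω - a) * (h ω - b) ∂μ := by
        refine integral_nonneg_of_ae ?_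
        filter_upwards [hfa, hhb] with t h1 h2
        exact mul_nonneg (sub_nonneg.2 h1) (sub_nonneg.2 h2)
      rw [← ENNReal.ofReal_le_ofReal_iff hnn', e, e']
      refine lintegral_mono fun p => ?_
      rw [hν, measure_lt_and_lt_of_monovaryOn hA hmonoA]
    rw [this]

end Rearrangement

/-! ### Quantile functions and spectral risk measures -/

section Quantile

variable {Ω : Type*} [MeasurableSpace Ω] {P : Measure Ω}

lemma quantile_congr {X Y : Ω → ℝ} (h : X =ᵐ[P] Y) : quantile P X = quantile P Y := by
  have key : ∀ x, P.real {ω | X ω ≤ x} = P.real {ω | Y ω ≤ x} := fun x => by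
    refine measureReal_congr ?_
    filter_upwards [h] with ω hω
    change (X ω ≤ x) = (Y ω ≤ x)
    rw [hω]
  funext p
  simp only [quantile, rightQuantile, leftQuantile, key]

lemma spectralRisk_eq (g : ℝ → ℝ) (X : Ω → ℝ) :
    spectralRisk P g X = ∫ t in Ioo (0 : ℝ) 1, leftQuantile P X t * g t := by
  rw [spectralRisk, intervalIntegral.integral_of_le zero_le_one, integral_Ioc_eq_integral_Ioo]
  refine setIntegral_congr_fun measurableSet_Ioo fun t ht => ?_
  simp only [quantile, if_neg ht.1.ne', mul_comm]

variable [IsProbabilityMeasure P]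

/-- The Galois connection between the quantile function and the distribution function. -/
lemma leftQuantile_le_iff {X : Ω → ℝ} (hX : AEMeasurable X P) {p : ℝ} (hp : p ∈ Ioo (0 : ℝ) 1)
    (x : ℝ) : leftQuantile P X p ≤ x ↔ p ≤ P.real {ω | X ω ≤ x} := by
  have := Measure.isProbabilityMeasure_map hX
  have hF : ∀ x, P.real {ω | X ω ≤ x} = cdf (P.map X) x := fun x => by
    rw [cdf_eq_real, measureReal_def, measureReal_def, Measure.map_apply_of_aemeasurable hX
      measurableSet_Iic]
    rfl
  simp only [leftQuantile, hF]
  set F := cdf (P.map X)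
  have hne : {x : ℝ | p ≤ F x}.Nonempty :=
    ((tendsto_cdf_atTop (P.map X)).eventually_const_le hp.2).exists
  have hbdd : BddBelow {x : ℝ | p ≤ F x} := by
    obtain ⟨m, hm⟩ := ((tendsto_cdf_atBot (P.map X)).eventually_lt_const hp.1).exists
    refine ⟨m, fun x hx => ?_⟩
    by_contra! hlt
    exact absurd ((F.mono hlt.le).trans_lt hm) (not_lt.2 hx)
  refine ⟨fun h => ?_, fun h => csInf_le hbdd h⟩
  -- the distribution function is at least `p` at every point above `x`, hence also at `x`
  have hlim : Tendsto F (𝓝[>] x) (𝓝 (F x)) :=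
    (F.right_continuous x).mono_left (nhdsWithin_mono _ Ioi_subset_Ici_self)
  refine ge_of_tendsto hlim ?_
  filter_upwards [self_mem_nhdsWithin] with y hy
  obtain ⟨z, hz, hzy⟩ := (csInf_lt_iff hbdd hne).1 (h.trans_lt hy)
  exact le_trans hz (F.mono hzy.le)

lemma monotoneOn_leftQuantile {X : Ω → ℝ} (hX : AEMeasurable X P) :
    MonotoneOn (leftQuantile P X) (Ioo 0 1) := fun p hp q hq hpq => by
  rw [leftQuantile_le_iff hX hp]
  exact hpq.trans ((leftQuantile_le_iff hX hq _).1 le_rfl)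

instance isProbabilityMeasure_volume_restrict_Ioo :
    IsProbabilityMeasure (volume.restrict (Ioo (0 : ℝ) 1)) :=
  ⟨by simp⟩

lemma identDistrib_leftQuantile {X : Ω → ℝ} (hX : AEMeasurable X P) :
    IdentDistrib X (leftQuantile P X) P (volume.restrict (Ioo 0 1)) := by
  have hQ : AEMeasurable (leftQuantile P X) (volume.restrict (Ioo 0 1)) :=
    aemeasurable_restrict_of_monotoneOn measurableSet_Ioo (monotoneOn_leftQuantile hX)
  refine ⟨hX, hQ, ?_⟩
  have := Measure.isProbabilityMeasure_map hX
  have := Measure.isProbabilityMeasure_map hQ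
  refine Measure.ext_of_Iic _ _ fun x => ?_
  rw [Measure.map_apply_of_aemeasurable hX measurableSet_Iic,
    Measure.map_apply_of_aemeasurable hQ measurableSet_Iic,
    Measure.restrict_apply' measurableSet_Ioo]
  set c := P.real {ω | X ω ≤ x} with hc
  have hset : leftQuantile P X ⁻¹' Iic x ∩ Ioo 0 1 = Iic c ∩ Ioo 0 1 := by
    ext p
    simp only [mem_inter_iff, mem_preimage, mem_Iic]
    exact and_congr_left fun hp => leftQuantile_le_iff hX hp x
  have hae : (Iic c ∩ Ioo 0 1 : Set ℝ) =ᵐ[volume] (Ioc 0 c : Set ℝ) := by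
    have : (Iic c ∩ Ioc 0 1 : Set ℝ) = Ioc 0 c := by
      ext p
      have : c ≤ 1 := measureReal_le_one
      simp only [mem_inter_iff, mem_Iic, mem_Ioc]
      constructor
      · rintro ⟨h1, h2, h3⟩; exact ⟨h2, h1⟩
      · rintro ⟨h1, h2⟩; exact ⟨h2, h1, h2.trans this⟩
    rw [← this]
    exact ae_eq_set_inter (ae_eq_refl _) Ioo_ae_eq_Ioc
  rw [hset, measure_congr hae, Real.volume_Ioc, sub_zero, hc, ofReal_measureReal]
  rfl

/-- If `Z` has quantile function `g`, then `ρ_g(X)` is the maximal value of `E[XZ]`, attained exactly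
when `X` and `Z` are comonotone. -/
lemma integral_mul_le_spectralRisk {g : ℝ → ℝ} (hg : IsRiskSpectrum g) {X Z : Ω → ℝ}
    (hX : MemLp X ∞ P) (hZ : AEMeasurable Z P) (hZg : ∀ p ∈ Icc (0 : ℝ) 1, quantile P Z p = g p) :
    MemLp Z ∞ P ∧ ∫ ω, X ω * Z ω ∂P ≤ spectralRisk P g X ∧
      (∫ ω, X ω * Z ω ∂P = spectralRisk P g X ↔ ∃ A ∈ ae P, MonovaryOn X Z A) := by
  have hQg : EqOn (leftQuantile P Z) g (Ioo 0 1) := fun p hp => by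
    rw [← hZg p (Ioo_subset_Icc_self hp), quantile, if_neg hp.1.ne']
  have hZd := identDistrib_leftQuantile hZ
  have hZL : MemLp Z ∞ P := by
    refine hZd.memLp_iff.2 (memLp_top_of_bound hZd.aemeasurable_snd.aestronglyMeasurable (g 1) ?_)
    filter_upwards [self_mem_ae_restrict measurableSet_Ioo] with t ht
    rw [hQg ht, Real.norm_eq_abs, abs_of_nonneg (hg.nonneg t (Ioo_subset_Icc_self ht))]
    exact hg.mono (Ioo_subset_Icc_self ht) (right_mem_Icc.2 zero_le_one) ht.2.le
  have hmono : MonovaryOn (leftQuantile P X) (leftQuantile P Z) (Ioo 0 1) :=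
    (monotoneOn_leftQuantile hX.1.aemeasurable).monovaryOn
      (monotoneOn_leftQuantile hZ)
  have key := integral_mul_le_of_identDistrib_of_monovaryOn
    (identDistrib_leftQuantile hX.1.aemeasurable) hZd hX hZL
    (self_mem_ae_restrict measurableSet_Ioo) hmono
  have hρ : spectralRisk P g X = ∫ t in Ioo (0 : ℝ) 1, leftQuantile P X t * leftQuantile P Z t := by
    rw [spectralRisk_eq]
    exact setIntegral_congr_fun measurableSet_Ioo fun t ht => by simp only [hQg ht]
  rw [hρ]
  exact ⟨hZL, key⟩

/-- Evaluating a risk spectrum at a uniform variable yields a variable with that quantile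
function. -/
lemma quantile_comp_uniform {g : ℝ → ℝ} (hg : IsRiskSpectrum g) {U : Ω → ℝ}
    (hU01 : ∀ ω, U ω ∈ Icc (0 : ℝ) 1)
    (hU : ∀ u ∈ Icc (0 : ℝ) 1, P.real {ω | U ω ≤ u} = u) {p : ℝ} (hp : p ∈ Icc (0 : ℝ) 1) :
    quantile P (fun ω => g (U ω)) p = g p := by
  have h0 : (0 : ℝ) ∈ Icc (0 : ℝ) 1 := left_mem_Icc.2 zero_le_one
  have hlow : ∀ q ∈ Icc (0 : ℝ) 1, ∀ x, g q ≤ x → q ≤ P.real {ω | g (U ω) ≤ x} := by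
    intro q hq x hx
    nth_rewrite 1 [← hU q hq]
    exact measureReal_mono fun ω hω => (hg.mono (hU01 ω) hq hω).trans hx
  rcases hp.1.eq_or_lt with rfl | hp0
  · rw [quantile, if_pos rfl, rightQuantile]
    have hpos : ∀ x, g 0 < x → 0 < P.real {ω | g (U ω) ≤ x} := by
      intro x hx
      obtain ⟨q, hqx, hq⟩ := ((hg.rightCont_zero.eventually_lt_const hx).and
        (Ioc_mem_nhdsGT (zero_lt_one' ℝ))).exists
      exact hq.1.trans_le (hlow q ⟨hq.1.le, hq.2⟩ x hqx.le)
    refine csInf_eq_of_forall_ge_of_forall_gt_exists_lt ⟨g 0 + 1, hpos _ (lt_add_one _)⟩ ?_ ?_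
    · intro x hx
      by_contra! hlt
      have hemp : {ω | g (U ω) ≤ x} = ∅ := by
        ext ω
        simpa using hlt.trans_le (hg.mono h0 (hU01 ω) (hU01 ω).1)
      simp only [mem_ofPred_eq, hemp, measureReal_empty, lt_irrefl] at hx
    · intro w hw
      obtain ⟨y, hy1, hy2⟩ := exists_between hw
      exact ⟨y, hpos y hy1, hy2⟩
  · rw [quantile, if_neg hp0.ne', leftQuantile]
    have hset : {x : ℝ | p ≤ P.real {ω | g (U ω) ≤ x}} = Ici (g p) := by
      ext x
      refine ⟨fun hx => ?_, hlow p hp x⟩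
      by_contra hlt
      rw [mem_Ici, not_le] at hlt
      obtain ⟨q, hqx, hq⟩ := (((hg.leftCont p ⟨hp0, hp.2⟩).eventually_const_lt hlt).and
        (Ico_mem_nhdsLT hp0)).exists
      have hq01 : q ∈ Icc (0 : ℝ) 1 := ⟨hq.1, hq.2.le.trans hp.2⟩
      have : P.real {ω | g (U ω) ≤ x} ≤ P.real {ω | U ω ≤ q} := by
        refine measureReal_mono fun ω hω => ?_
        by_contra hqω
        rw [mem_ofPred_eq, not_le] at hqω
        exact absurd (hg.mono hq01 (hU01 ω) hqω.le) (not_le.2 (lt_of_le_of_lt hω hqx))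
      rw [hU q hq01] at this
      exact absurd (le_trans hx this) (not_le.2 hq.2)
    rw [hset, csInf_Ici]

end Quantile

/-! ### Uniform random variables on atomless spaces -/

section Atomless

variable {Ω : Type*} [MeasurableSpace Ω] {P : Measure Ω} [IsProbabilityMeasure P]

/-- An atomless probability space carries a random variable all of whose level sets are null: one
minimises the probability that two independent copies coincide. A minimiser exists since
countably many random variables can be encoded in a single one, and a level set of
positive probability could be split, which would lower the minimum. -/
lemma IsAtomless.exists_measure_preimage_singleton_eq_zero (hP : IsAtomless P) :
    ∃ V : Ω → ℝ, Measurable V ∧ ∀ c, P (V ⁻¹' {c}) = 0 := by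
  let E : (Ω → ℝ) → Set (Ω × Ω) := fun V => {p | V p.1 = V p.2}
  have hE : ∀ V, Measurable V → MeasurableSet (E V) := fun V hV =>
    measurableSet_eq_fun (hV.comp measurable_fst) (hV.comp measurable_snd)
  let Φ : {V : Ω → ℝ // Measurable V} → ℝ≥0∞ := fun V => (P.prod P) (E V.1)
  obtain ⟨u, -, hu, hmem⟩ := exists_seq_tendsto_sInf (S := range Φ) ⟨_, ⟨0, measurable_zero⟩, rfl⟩
    (OrderBot.bddBelow _)
  choose W hW using hmem
  obtain ⟨e, he⟩ := exists_measurableEmbedding_real (ℕ → ℝ)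
  let V : Ω → ℝ := fun ω => e fun n => (W n).1 ω
  have hV : Measurable V := he.measurable.comp (measurable_pi_lambda _ fun n => (W n).2)
  have hmin : ∀ V', Measurable V' → (P.prod P) (E V) ≤ (P.prod P) (E V') := by
    intro V' hV'
    refine le_trans (ge_of_tendsto' hu fun n => ?_) (sInf_le ⟨⟨V', hV'⟩, rfl⟩)
    rw [← hW n]
    exact measure_mono fun p hp => congrFun (he.injective hp) n
  refine ⟨V, hV, fun c => ?_⟩
  by_contra hc
  obtain ⟨B, hB, hBA, hB0, hBlt⟩ := hP _ (hV (measurableSet_singleton c)) (pos_iff_ne_zero.2 hc)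
  obtain ⟨e', he'⟩ := exists_measurableEmbedding_real (ℝ × ℝ)
  let V' : Ω → ℝ := fun ω => e' (V ω, B.indicator 1 ω)
  have hV' : Measurable V' :=
    he'.measurable.comp (hV.prodMk (measurable_one.indicator hB))
  -- pairs separated by `B` within the level set coincide under `V` but no longer under `V'`
  have hsub : E V' ⊆ E V \ (B ×ˢ (V ⁻¹' {c} \ B)) := by
    rintro ⟨x, y⟩ hxy
    have h := he'.injective hxy
    simp only [Prod.mk.injEq] at h
    refine ⟨h.1, ?_⟩
    rintro ⟨hx, -, hy⟩
    have h2 := h.2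
    rw [indicator_of_mem hx, indicator_of_notMem hy] at h2
    exact one_ne_zero h2
  have hprod : B ×ˢ (V ⁻¹' {c} \ B) ⊆ E V := by
    rintro ⟨x, y⟩ ⟨hx, hy, -⟩
    exact (hBA hx).trans hy.symm
  have hdiff : 0 < P (V ⁻¹' {c} \ B) :=
    (tsub_pos_of_lt hBlt).trans_le le_measure_sdiff
  have hlt : (P.prod P) (E V \ (B ×ˢ (V ⁻¹' {c} \ B))) < (P.prod P) (E V) := by
    rw [measure_sdiff hprod (hB.prod ((hV (measurableSet_singleton c)).diff hB)).nullMeasurableSet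
      (measure_ne_top _ _)]
    refine ENNReal.sub_lt_self (measure_ne_top _ _) ?_ ?_
    · refine (lt_of_lt_of_le ?_ (measure_mono hprod)).ne'
      rw [Measure.prod_prod]
      exact ENNReal.mul_pos hB0.ne' hdiff.ne'
    · rw [Measure.prod_prod]
      exact mul_ne_zero hB0.ne' hdiff.ne'
  exact absurd ((hmin V' hV').trans (measure_mono hsub)) (not_le.2 hlt)

/-- The atoms of `S` can be spread out into intervals without changing the order of the values
of `S`. -/
lemma IsAtomless.exists_refinement (hP : IsAtomless P) {S : Ω → ℝ} (hS : Measurable S) :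
    ∃ T : Ω → ℝ, Measurable T ∧ (∀ c, P (T ⁻¹' {c}) = 0) ∧ ∀ ω ω', S ω < S ω' → T ω < T ω' := by
  obtain ⟨V, hV, hV0⟩ := hP.exists_measure_preimage_singleton_eq_zero
  let F : ℝ → ℝ := fun x => P.real {ω | S ω ≤ x}
  let G : ℝ → ℝ := fun x => P.real {ω | S ω < x}
  have hF : Monotone F := fun x y hxy => measureReal_mono fun ω hω => le_trans hω hxy
  have hG : Monotone G := fun x y hxy => measureReal_mono fun ω hω => lt_of_lt_of_le hω hxy
  have hGF : ∀ x, G x ≤ F x := fun x =>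
    measureReal_mono fun ω (hω : S ω < x) => hω.le
  have hFG : ∀ x y, x < y → F x ≤ G y := fun x y hxy =>
    measureReal_mono fun ω hω => lt_of_le_of_lt hω hxy
  have hatom : ∀ x, F x - G x = P.real (S ⁻¹' {x}) := fun x => by
    have hset : S ⁻¹' {x} = {ω | S ω ≤ x} \ {ω | S ω < x} := by
      ext ω
      simp only [mem_preimage, mem_singleton_iff, Set.mem_sdiff, mem_ofPred_eq, not_lt]
      exact le_antisymm_iff
    have hsub : {ω | S ω < x} ⊆ {ω | S ω ≤ x} := fun ω (hω : S ω < x) => hω.le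
    rw [hset, measureReal_sdiff hsub (measurableSet_lt hS measurable_const)]
  -- an atom `x` of `S` is spread over an interval of length `P(S = x)` by means of `V`; the summand
  -- `S ω` makes `T` strictly increasing in `S` also where the distribution function is flat
  let T : Ω → ℝ := fun ω => S ω + (G (S ω) + (F (S ω) - G (S ω)) * Real.sigmoid (V ω))
  have hST : ∀ ω ω', S ω < S ω' → T ω < T ω' := by
    intro ω ω' h
    have h1 : (F (S ω) - G (S ω)) * Real.sigmoid (V ω) ≤ F (S ω) - G (S ω) :=
      mul_le_of_le_one_right (sub_nonneg.2 (hGF _)) (Real.sigmoid_le_one _)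
    have h2 : 0 ≤ (F (S ω') - G (S ω')) * Real.sigmoid (V ω') :=
      mul_nonneg (sub_nonneg.2 (hGF _)) (Real.sigmoid_nonneg _)
    have h3 := hFG _ _ h
    simp only [T]
    linarith
  refine ⟨T, ?_, fun c => ?_, hST⟩
  · have := hF.measurable
    have := hG.measurable
    have := Real.sigmoid_strictMono.monotone.measurable
    fun_prop
  · rcases (T ⁻¹' {c}).eq_empty_or_nonempty with hemp | ⟨ω₀, hω₀⟩
    · rw [hemp, measure_empty]
    have hSeq : ∀ ω ∈ T ⁻¹' {c}, S ω = S ω₀ := by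
      intro ω hω
      have hT : T ω = T ω₀ := Eq.trans hω (Eq.symm hω₀)
      rcases lt_trichotomy (S ω) (S ω₀) with h | h | h
      · exact absurd hT (hST _ _ h).ne
      · exact h
      · exact absurd hT (hST _ _ h).ne'
    by_cases hm : F (S ω₀) - G (S ω₀) = 0
    · rw [hatom, measureReal_eq_zero_iff] at hm
      exact measure_mono_null hSeq hm
    · refine measure_mono_null (fun ω hω => ?_) (hV0 (V ω₀))
      have hT : T ω = T ω₀ := Eq.trans hω (Eq.symm hω₀)
      simp only [T, hSeq ω hω, add_right_inj, mul_right_inj' hm] at hT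
      exact Real.sigmoid_strictMono.injective hT

/-- The probability integral transform. -/
lemma exists_uniform_of_measure_preimage_singleton_eq_zero {T : Ω → ℝ} (hT : Measurable T)
    (hT0 : ∀ c, P (T ⁻¹' {c}) = 0) :
    ∃ F : ℝ → ℝ, Monotone F ∧ (∀ x, F x ∈ Icc (0 : ℝ) 1) ∧
      ∀ u ∈ Icc (0 : ℝ) 1, P.real {ω | F (T ω) ≤ u} = u := by
  have := Measure.isProbabilityMeasure_map (μ := P) hT.aemeasurable
  set F := cdf (P.map T) with hFdef
  have hF : ∀ x, P.real {ω | T ω ≤ x} = F x := fun x => by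
    rw [hFdef, cdf_eq_real, map_measureReal_apply hT measurableSet_Iic]
    rfl
  have hcont : Continuous F := by
    refine continuous_iff_continuousAt.2 fun x => ?_
    have h0 : F.measure {x} = 0 := by
      rw [hFdef, measure_cdf, Measure.map_apply hT (measurableSet_singleton x), hT0]
    rw [StieltjesFunction.measure_singleton, ENNReal.ofReal_eq_zero, sub_nonpos] at h0
    refine continuousAt_iff_continuous_left'_right'.2 ⟨?_, ?_⟩
    · exact F.mono.continuousWithinAt_Iio_iff_leftLim_eq.2
        (le_antisymm (F.mono.leftLim_le le_rfl) h0)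
    · exact (F.right_continuous x).mono Ioi_subset_Ici_self
  have hsurj : ∀ v ∈ Ioo (0 : ℝ) 1, ∃ x, F x = v := fun v hv =>
    mem_range_of_exists_le_of_exists_ge hcont
      ((tendsto_cdf_atBot (P.map T)).eventually_le_const hv.1).exists
      ((tendsto_cdf_atTop (P.map T)).eventually_const_le hv.2).exists
  refine ⟨F, F.mono, fun x => ⟨cdf_nonneg _ x, cdf_le_one _ x⟩, fun u hu => le_antisymm ?_ ?_⟩
  · refine le_of_forall_gt_imp_ge_of_dense fun v hv => ?_
    rcases le_or_gt 1 v with h1 | h1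
    · exact measureReal_le_one.trans h1
    obtain ⟨y, rfl⟩ := hsurj v ⟨hu.1.trans_lt hv, h1⟩
    rw [← hF]
    exact measureReal_mono fun ω hω => (F.mono.reflect_lt (lt_of_le_of_lt hω hv)).le
  · rcases hu.1.eq_or_lt with rfl | h0
    · exact measureReal_nonneg
    rcases hu.2.eq_or_lt with rfl | h1
    · have : {ω | F (T ω) ≤ 1} = univ := eq_univ_of_forall fun ω => cdf_le_one _ _
      rw [this, probReal_univ]
    obtain ⟨x, rfl⟩ := hsurj u ⟨h0, h1⟩
    nth_rewrite 1 [← hF]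
    exact measureReal_mono fun ω hω => F.mono hω

/-- Every random variable is comonotone with some `Z` of prescribed quantile function. -/
lemma IsAtomless.exists_quantile_eq_and_monovaryOn (hP : IsAtomless P) {g : ℝ → ℝ}
    (hg : IsRiskSpectrum g) {S : Ω → ℝ} (hS : AEMeasurable S P) :
    ∃ Z : Ω → ℝ, Measurable Z ∧ (∀ p ∈ Icc (0 : ℝ) 1, quantile P Z p = g p) ∧
      ∃ A ∈ ae P, MonovaryOn S Z A := by
  obtain ⟨T, hT, hT0, hST⟩ := hP.exists_refinement hS.measurable_mk
  obtain ⟨F, hF, hF01, hU⟩ := exists_uniform_of_measure_preimage_singleton_eq_zero hT hT0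
  have hgF : Monotone fun x => g (F x) := fun x y hxy => hg.mono (hF01 x) (hF01 y) (hF hxy)
  refine ⟨fun ω => g (F (T ω)), hgF.measurable.comp hT,
    fun p hp => quantile_comp_uniform hg (fun ω => hF01 (T ω)) hU hp, _, hS.ae_eq_mk, ?_⟩
  intro ω hω ω' hω' hlt
  by_contra! hlt'
  rw [show S ω = _ from hω, show S ω' = _ from hω'] at hlt'
  exact absurd hlt (not_lt.2 (hgF (hST _ _ hlt').le))

end Atomless

/-! ### Comonotonic pairs -/

section Comonotonic

variable {Ω : Type*} [MeasurableSpace Ω] {P : Measure Ω} [IsProbabilityMeasure P]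

/-- For bounded pairs, the representation by monotone functions of a common variable agrees with
the pointwise comonotonicity condition off a null set; the sum `X + Z` serves as the common
variable. -/
lemma comonotonic_pair_iff {X Z : Ω → ℝ} (hX : MemLp X ∞ P) (hZ : MemLp Z ∞ P) :
    Comonotonic P ![X, Z] ↔ ∃ A ∈ ae P, MonovaryOn X Z A := by
  constructor
  · rintro ⟨W, f, -, hf, hae⟩
    refine ⟨_, hae, fun ω hω ω' hω' hlt => ?_⟩
    have e0 := hω 0
    have e1 := hω 1
    have e0' := hω' 0
    have e1' := hω' 1
    simp only [Matrix.cons_val_zero, Matrix.cons_val_one] at e0 e1 e0' e1'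
    rw [e1, e1'] at hlt
    rw [e0, e0']
    exact hf 0 ((hf 1).reflect_lt hlt).le
  · rintro ⟨A, hA, hmono⟩
    obtain ⟨M, hM⟩ := exists_ae_abs_le hX
    obtain ⟨N, hN⟩ := exists_ae_abs_le hZ
    let X' := hX.1.aemeasurable.mk X
    let Z' := hZ.1.aemeasurable.mk Z
    let A' : Set Ω := {ω | ω ∈ A ∧ |X ω| ≤ M ∧ |Z ω| ≤ N ∧ X ω = X' ω ∧ Z ω = Z' ω}
    have hA' : A' ∈ ae P := by
      filter_upwards [hA, hM, hN, hX.1.aemeasurable.ae_eq_mk, hZ.1.aemeasurable.ae_eq_mk]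
        with ω h1 h2 h3 h4 h5 using ⟨h1, h2, h3, h4, h5⟩
    have hsum : ∀ ω ∈ A', ∀ ω' ∈ A', X ω + Z ω ≤ X ω' + Z ω' → X ω ≤ X ω' ∧ Z ω ≤ Z ω' := by
      intro ω hω ω' hω' h
      constructor
      · by_contra! hlt
        have := hmono.symm hω'.1 hω.1 hlt
        linarith
      · by_contra! hlt
        have := hmono hω'.1 hω.1 hlt
        linarith
    have := nonempty_of_isProbabilityMeasure P
    have hext : ∀ Y : Ω → ℝ, (∃ K, ∀ ω ∈ A', |Y ω| ≤ K) →
        (∀ ω ∈ A', ∀ ω' ∈ A', X ω + Z ω ≤ X ω' + Z ω' → Y ω ≤ Y ω') →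
        ∃ f : ℝ → ℝ, Monotone f ∧ ∀ ω ∈ A', Y ω = f (X ω + Z ω) := by
      rintro Y ⟨K, hK⟩ hY
      have hinv : ∀ w ∈ (fun ω => X ω + Z ω) '' A', ∃ ω ∈ A', X ω + Z ω = w := fun w hw => hw
      choose! r hrA hrw using hinv
      have hmon : MonotoneOn (fun w => Y (r w)) ((fun ω => X ω + Z ω) '' A') := by
        intro w hw w' hw' hww
        refine hY _ (hrA w hw) _ (hrA w' hw') ?_
        rw [hrw w hw, hrw w' hw']
        exact hww
      obtain ⟨f, hf, hfe⟩ := hmon.exists_monotone_extension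
        ⟨-K, by rintro _ ⟨w, hw, rfl⟩; exact neg_le_of_abs_le (hK _ (hrA w hw))⟩
        ⟨K, by rintro _ ⟨w, hw, rfl⟩; exact le_of_abs_le (hK _ (hrA w hw))⟩
      refine ⟨f, hf, fun ω hω => ?_⟩
      have hw : X ω + Z ω ∈ (fun ω => X ω + Z ω) '' A' := ⟨ω, hω, rfl⟩
      rw [← hfe hw]
      exact le_antisymm (hY _ hω _ (hrA _ hw) (hrw _ hw).ge) (hY _ (hrA _ hw) _ hω (hrw _ hw).le)
    obtain ⟨f, hf, hfe⟩ := hext X ⟨M, fun ω hω => hω.2.1⟩ fun ω hω ω' hω' h =>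
      (hsum ω hω ω' hω' h).1
    obtain ⟨k, hk, hke⟩ := hext Z ⟨N, fun ω hω => hω.2.2.1⟩ fun ω hω ω' hω' h =>
      (hsum ω hω ω' hω' h).2
    refine ⟨fun ω => X' ω + Z' ω, ![f, k],
      hX.1.aemeasurable.measurable_mk.add hZ.1.aemeasurable.measurable_mk, ?_, ?_⟩
    · simp [Fin.forall_fin_two, hf, hk]
    · filter_upwards [hA'] with ω hω
      rw [← hω.2.2.2.1, ← hω.2.2.2.2]
      simp [← hfe ω hω, ← hke ω hω]

end Comonotonic

end SpectralRisk

theorem mainTheorem2 {Ω : Type*} [MeasurableSpace Ω] (P : Measure Ω) [IsProbabilityMeasure P]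
    (hP : SpectralRisk.IsAtomless P) (g : ℝ → ℝ) (hg : SpectralRisk.IsRiskSpectrum g)
    (d : ℕ) (X : Fin d → Ω → ℝ) (hX : ∀ i, MemLp (X i) ∞ P) :
    SpectralRisk.AdditiveOn (SpectralRisk.spectralRisk P g) X ↔
      SpectralRisk.GComonotonic P g X := by
  have hS : MemLp (fun ω => ∑ i, X i ω) ∞ P := memLp_finsetSum _ fun i _ => hX i
  have hsum : ∀ Z : Ω → ℝ, MemLp Z ∞ P →
      ∫ ω, (∑ i, X i ω) * Z ω ∂P = ∑ i, ∫ ω, X i ω * Z ω ∂P := by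
    intro Z hZ
    simp only [Finset.sum_mul]
    exact integral_finsetSum _ fun i _ => MemLp.integrable le_top (hZ.mul (hX i))
  constructor
  · intro hadd
    obtain ⟨Z, hZm, hZg, hSZ⟩ :=
      hP.exists_quantile_eq_and_monovaryOn hg hS.1.aemeasurable
    obtain ⟨hZ, -, hSiff⟩ := SpectralRisk.integral_mul_le_spectralRisk hg hS hZm.aemeasurable hZg
    have hX' := fun i =>
      (SpectralRisk.integral_mul_le_spectralRisk hg (hX i) hZm.aemeasurable hZg).2
    have heq := hSiff.2 hSZ
    -- two equal sums whose terms are ordered termwise have equal terms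
    rw [hsum Z hZ, show SpectralRisk.spectralRisk P g (fun ω => ∑ i, X i ω) = _ from hadd,
      Finset.sum_eq_sum_iff_of_le fun i _ => (hX' i).1] at heq
    exact ⟨Z, hZm, hZg, fun i => (SpectralRisk.comonotonic_pair_iff (hX i) hZ).2
      ((hX' i).2.1 (heq i (Finset.mem_univ i)))⟩
  · rintro ⟨Z, hZm, hZg, hcom⟩
    obtain ⟨hZ, -, hSiff⟩ := SpectralRisk.integral_mul_le_spectralRisk hg hS hZm.aemeasurable hZg
    choose A hA hmono using fun i => (SpectralRisk.comonotonic_pair_iff (hX i) hZ).1 (hcom i)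
    have hSeq := hSiff.2 ⟨⋂ i, A i, countable_iInter_mem.2 hA, fun ω hω ω' hω' hlt =>
      Finset.sum_le_sum fun i _ => hmono i (mem_iInter.1 hω i) (mem_iInter.1 hω' i) hlt⟩
    rw [SpectralRisk.AdditiveOn, ← hSeq, hsum Z hZ]
    exact Finset.sum_congr rfl fun i _ =>
      (SpectralRisk.integral_mul_le_spectralRisk hg (hX i) hZm.aemeasurable hZg).2.2.2
        ⟨A i, hA i, hmono i⟩
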